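/- **Counter-example to uniqueness.** Let $T=\pi/4$ and let $W=(W_t)_{0\le t\le T}$ be a one-dimensional Wiener process on a probability space $(\Omega,\mathcal F,\mathbb P)$, with augmented filtration $\mathbb F$. Let $\mathcal P_2(E)$ be the set of probability measures on $E$ with a finite second moment, with the 2-Wasserstein distance $W_2$. For Borel measurable coefficients $B,F:[0,T]\times\mathbb R^3\times\mathcal P_2(\mathbb R^2)\to\mathbb R$, $\Sigma:[0,T]\times\mathbb R^2\times\mathcal P_2(\mathbb R^2)\to\mathbb R$, $G:\mathbb R\times\mathcal P_2(\mathbb R)\to\mathbb R$, consider the McKean–Vlasov forward-backward system $$dX_t=B(t,X_t,Y_t,Z_t,\mathbb P_{(X_t,Y_t)})\,dt+\Sigma(t,X_t,Y_t,\mathbb P_{(X_t,Y_t)})\,dW_t,\qquad X_0=x_0,$$ $$dY_t=-F(t,X_t,Y_t,Z_t,\mathbb P_{(X_t,Y_t)})\,dt+Z_t\,dW_t,\qquad Y_T=G(X_T,\mathbb P_{X_T}),$$ where a solution consists of continuous $\mathbb F$-adapted processes $X,Y$ with $\sup_{0\le t\le T}\mathbb E[|X_t|^2+|Y_t|^2]<\infty$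 and an $\mathbb F$-progressively measurable process $Z$ with $\mathbb E\int_0^T|Z_t|^2dt<\infty$. The assumptions are that, for some $L\ge1$, for all $t\in[0,T]$ and all values of the other arguments: * (A1) $|B(t,x',y',z',\mu')-B(t,x,y,z,\mu)|+|F(t,x',y',z',\mu')-F(t,x,y,z,\mu)|+|\Sigma(t,x',y',\mu')-\Sigma(t,x,y,\mu)|\le L[\,|(x,y,z)-(x',y',z')|+W_2(\mu,\mu')]$ and $|G(x',\nu')-G(x,\nu)|\le L[\,|x-x'|+W_2(\nu,\nu')]$; * (A2) $|\Sigma|\le L$, $|G|\le L$, $|B(t,x,y,z,\mu)|\le L[1+|x|+|y|+|z|+(\int|(x',y')|^2d\mu(x',y'))^{1/2}]$ and $|F(t,x,y,z,\mu)|\le L[1+|y|+(\int|y'|^2d\mu(x',y'))^{1/2}]$; * (A3) $\Sigma(t,x,y,\mu)^2\ge L^{-1}$, and $t\mapsto\Sigma(t,0,0,\delta_{(0,0)})$ is continuous on $[0,T]$. Then there are coefficients satisfying (A1)–(A3) for which the system with $x_0=0$ has more than one solution. More precisely, let $R\in\mathbb R$ and let $B,F,G:\mathbb R\to\mathbb R$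 be bounded and Lipschitz continuous with $B(x)=F(x)=G(x)=x$ for $|x|\le R$. Then the system $$dX_t=B(\mathbb E Y_t)\,dt+dW_t,\quad X_0=0,\qquad dY_t=-F(\mathbb E X_t)\,dt+Z_t\,dW_t,\quad Y_T=G(\mathbb E X_T),\qquad 0\le t\le T=\pi/4,$$ satisfies (A1)–(A3), and for every $A\in\mathbb R$ with $|A|\le R$ the triple $(A\sin t+W_t,\;A\cos t,\;0)_{0\le t\le T}$ is a solution. In particular, uniqueness fails if $R>0$. -/

import Mathlib

open MeasureTheory ProbabilityTheory Filter Topology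

noncomputable section

namespace McKeanVlasov

/-! ### Probability measures of order two and the 2-Wasserstein distance -/

/-- The set `𝒫₂(E)` of Borel probability measures on `E` with a finite second moment. -/
structure P2 (E : Type*) [NormedAddCommGroup E] [MeasurableSpace E] where
  toMeasure : Measure E
  isProb : IsProbabilityMeasure toMeasure
  memLp : MemLp id 2 toMeasure

/-- `ℝ × ℝ` with its Euclidean norm. -/
abbrev Plane : Type := WithLp 2 (ℝ × ℝ)

/-- `π` is a coupling of `μ` and `ν`: its marginals are `μ` and `ν`. -/
def IsCoupling {E : Type*} [MeasurableSpace E] (μ ν : Measure E) (π : Measure (E × E)) : Prop :=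
  π.map Prod.fst = μ ∧ π.map Prod.snd = ν

/-- The 2-Wasserstein distance
`W₂(μ, ν) = inf {(∫ |x - y|² dπ(x, y))^{1/2} : π a coupling of μ and ν}`.
The infimum is finite on `𝒫₂(E)`, so no information is lost in passing to real numbers. -/
def W2 {E : Type*} [NormedAddCommGroup E] [MeasurableSpace E] (μ ν : P2 E) : ℝ :=
  (⨅ (π : Measure (E × E)) (_ : IsCoupling μ.toMeasure ν.toMeasure π),
    (∫⁻ p, edist p.1 p.2 ^ 2 ∂π) ^ (1 / 2 : ℝ)).toReal

/-- The topology of the 2-Wasserstein distance, generated by its open balls. -/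
instance P2.instTopologicalSpace {E : Type*} [NormedAddCommGroup E] [MeasurableSpace E] :
    TopologicalSpace (P2 E) :=
  TopologicalSpace.generateFrom {U | ∃ (μ : P2 E) (r : ℝ), U = {ν | W2 μ ν < r}}

/-- `𝒫₂(E)` carries the Borel `σ`-field of the 2-Wasserstein distance. -/
instance P2.instMeasurableSpace {E : Type*} [NormedAddCommGroup E] [MeasurableSpace E] :
    MeasurableSpace (P2 E) :=
  borel (P2 E)

/-- The Dirac mass at `x`, as an element of `𝒫₂(E)`. -/
def P2.dirac {E : Type*} [NormedAddCommGroup E] [MeasurableSpace E] [BorelSpace E]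
    [SecondCountableTopology E] (x : E) : P2 E where
  toMeasure := Measure.dirac x
  isProb := inferInstance
  memLp := by
    refine (memLp_const x).ae_eq ?_
    rw [EventuallyEq, ae_dirac_eq]
    rfl

open Classical in
/-- The law `ℙ_X ∈ 𝒫₂(E)` of a square integrable random variable `X`
(the value for an `X` that is not square integrable is irrelevant). -/
def law {Ω : Type*} [MeasurableSpace Ω] (P : Measure Ω) [IsProbabilityMeasure P]
    {E : Type*} [NormedAddCommGroup E] [MeasurableSpace E] [BorelSpace E]
    [SecondCountableTopology E] (X : Ω → E) : P2 E :=
  if h : MemLp X 2 P then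
    { toMeasure := P.map X
      isProb := Measure.isProbabilityMeasure_map h.1.aemeasurable
      memLp := (memLp_map_measure_iff aestronglyMeasurable_id h.1.aemeasurable).2 h }
  else P2.dirac 0

/-! ### Wiener process and Itô integral on `[0, T]`

Processes on `[0, T]` are functions `ℝ → Ω → ℝ` of which only the values at times in `[0, T]`
are used. -/

section Ito

variable {Ω : Type*} [MeasurableSpace Ω]

/-- The `σ`-field `σ(W_s, 0 ≤ s ≤ t)`. -/
@[reducible] def pastSigma (W : ℝ → Ω → ℝ) (t : ℝ) : MeasurableSpace Ω :=
  ⨆ s ∈ Set.Icc (0 : ℝ) t, MeasurableSpace.comap (W s) inferInstance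

/-- The filtration `𝓕_t` of `W`, augmented by the null events. -/
@[reducible] def wienerFiltration (P : Measure Ω) (W : ℝ → Ω → ℝ) (t : ℝ) : MeasurableSpace Ω :=
  pastSigma W t ⊔ MeasurableSpace.generateFrom {N | MeasurableSet N ∧ P N = 0}

/-- `W` is a one-dimensional Wiener process on `[0, T]`. -/
structure IsWiener (P : Measure Ω) (T : ℝ) (W : ℝ → Ω → ℝ) : Prop where
  measurable : ∀ t ∈ Set.Icc (0 : ℝ) T, Measurable (W t)
  zero : ∀ᵐ ω ∂P, W 0 ω = 0
  hasLaw_increment : ∀ s t : ℝ, 0 ≤ s → s ≤ t → t ≤ T →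
    HasLaw (fun ω ↦ W t ω - W s ω) (gaussianReal 0 (t - s).toNNReal) P
  indep_increment : ∀ s t : ℝ, 0 ≤ s → s ≤ t → t ≤ T →
    Indep (MeasurableSpace.comap (fun ω ↦ W t ω - W s ω) inferInstance) (pastSigma W s) P
  continuous : ∀ᵐ ω ∂P, ContinuousOn (fun t ↦ W t ω) (Set.Icc 0 T)

/-- `X_t` is `𝓕_t`-measurable for every `t ∈ [0, T]`. -/
def AdaptedOn (𝓕 : ℝ → MeasurableSpace Ω) (T : ℝ) (X : ℝ → Ω → ℝ) : Prop :=
  ∀ t ∈ Set.Icc (0 : ℝ) T, Measurable[𝓕 t] (X t)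

/-- Progressive measurability on `[0, T]`: for every `t ∈ [0, T]` the map `(s, ω) ↦ X_s(ω)` on
`[0, t] × Ω` is measurable for the product of the Borel `σ`-field and `𝓕_t`. -/
def ProgressiveOn (𝓕 : ℝ → MeasurableSpace Ω) (T : ℝ) (X : ℝ → Ω → ℝ) : Prop :=
  ∀ t ∈ Set.Icc (0 : ℝ) T,
    Measurable[@Prod.instMeasurableSpace (Set.Icc (0 : ℝ) t) Ω inferInstance (𝓕 t)]
      (fun p : Set.Icc (0 : ℝ) t × Ω ↦ X p.1 p.2)

/-- The space `ℍ²`: progressively measurable processes with `𝔼 ∫₀ᵀ |Z_s|² ds < ∞`. -/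
def MemH2 (P : Measure Ω) (𝓕 : ℝ → MeasurableSpace Ω) (T : ℝ) (Z : ℝ → Ω → ℝ) : Prop :=
  ProgressiveOn 𝓕 T Z ∧ ∫⁻ ω, (∫⁻ s in Set.Icc 0 T, ‖Z s ω‖ₑ ^ 2) ∂P < ⊤

/-- A simple process `∑_{i < n} ξ_i 1_{(t_i, t_{i+1}]}` with times `0 ≤ t_0 ≤ t_1 ≤ … ≤ T` and
bounded, `𝓕_{t_i}`-measurable `ξ_i`. -/
structure SimpleProcess (𝓕 : ℝ → MeasurableSpace Ω) (T : ℝ) where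
  n : ℕ
  t : ℕ → ℝ
  mono : Monotone t
  mem : ∀ i, t i ∈ Set.Icc (0 : ℝ) T
  ξ : ℕ → Ω → ℝ
  measurable : ∀ i, Measurable[𝓕 (t i)] (ξ i)
  bounded : ∀ i, ∃ C : ℝ, ∀ ω, |ξ i ω| ≤ C

/-- The value at time `s` of a simple process. -/
def SimpleProcess.val {𝓕 : ℝ → MeasurableSpace Ω} {T : ℝ} (S : SimpleProcess 𝓕 T)
    (s : ℝ) (ω : Ω) : ℝ :=
  ∑ i ∈ Finset.range S.n, (Set.Ioc (S.t i) (S.t (i + 1))).indicator (fun _ ↦ S.ξ i ω) s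

/-- The elementary stochastic integral
`∫₀ᵗ S dW = ∑_{i < n} ξ_i (W_{t_{i+1} ∧ t} - W_{t_i ∧ t})`. -/
def SimpleProcess.integral {𝓕 : ℝ → MeasurableSpace Ω} {T : ℝ} (S : SimpleProcess 𝓕 T)
    (W : ℝ → Ω → ℝ) (t : ℝ) (ω : Ω) : ℝ :=
  ∑ i ∈ Finset.range S.n, S.ξ i ω * (W (min (S.t (i + 1)) t) ω - W (min (S.t i) t) ω)

/-- `I = ∫₀^· H dW` on `[0, T]`: the Itô integral with respect to the Wiener process `W` of a
process `H` in the closure of the simple processes in `L²([0, T] × Ω, dt ⊗ ℙ)`. It is the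
continuous adapted process whose values are the `L²(ℙ)` limits of the elementary integrals of
simple processes approximating `H`; by Itô's isometry it does not depend on the approximation and
is unique up to indistinguishability. -/
structure IsItoIntegral (P : Measure Ω) (T : ℝ) (W H I : ℝ → Ω → ℝ) : Prop where
  aestronglyMeasurable : AEStronglyMeasurable (fun p : ℝ × Ω ↦ H p.1 p.2)
    ((volume.restrict (Set.Icc 0 T)).prod P)
  adapted : AdaptedOn (wienerFiltration P W) T I
  continuous : ∀ᵐ ω ∂P, ContinuousOn (fun t ↦ I t ω) (Set.Icc 0 T)
  approx : ∃ S : ℕ → SimpleProcess (wienerFiltration P W) T,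
    Tendsto (fun n ↦ ∫⁻ p, ‖(S n).val p.1 p.2 - H p.1 p.2‖ₑ ^ 2
      ∂((volume.restrict (Set.Icc 0 T)).prod P)) atTop (𝓝 0) ∧
    ∀ t ∈ Set.Icc 0 T,
      Tendsto (fun n ↦ ∫⁻ ω, ‖(S n).integral W t ω - I t ω‖ₑ ^ 2 ∂P) atTop (𝓝 0)

end Ito

/-! ### McKean–Vlasov forward-backward systems in dimensions `d = m = p = 1` -/

/-- The coefficients `B(t, x, y, z, μ)`, `F(t, x, y, z, μ)`, `Σ(t, x, y, μ)` and `G(x, ν)`, for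
`t ∈ [0, T]`, `x, y, z ∈ ℝ`, `μ ∈ 𝒫₂(ℝ × ℝ)`, `ν ∈ 𝒫₂(ℝ)`
(values at times outside `[0, T]` are irrelevant). -/
structure Coefficients where
  B : ℝ → ℝ → ℝ → ℝ → P2 Plane → ℝ
  F : ℝ → ℝ → ℝ → ℝ → P2 Plane → ℝ
  Sig : ℝ → ℝ → ℝ → P2 Plane → ℝ
  G : ℝ → P2 ℝ → ℝ

/-- The coefficients are Borel measurable on their domains. -/
structure Coefficients.BorelMeasurable (c : Coefficients) (T : ℝ) : Prop where
  measurable_B : Measurable (fun q : Set.Icc (0 : ℝ) T × ℝ × ℝ × ℝ × P2 Plane ↦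
    c.B q.1 q.2.1 q.2.2.1 q.2.2.2.1 q.2.2.2.2)
  measurable_F : Measurable (fun q : Set.Icc (0 : ℝ) T × ℝ × ℝ × ℝ × P2 Plane ↦
    c.F q.1 q.2.1 q.2.2.1 q.2.2.2.1 q.2.2.2.2)
  measurable_Sig : Measurable (fun q : Set.Icc (0 : ℝ) T × ℝ × ℝ × P2 Plane ↦
    c.Sig q.1 q.2.1 q.2.2.1 q.2.2.2)
  measurable_G : Measurable (fun q : ℝ × P2 ℝ ↦ c.G q.1 q.2)

/-- (A1): Lipschitz continuity, uniformly in time, with respect to the state variables and, for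
the 2-Wasserstein distance, with respect to the measure argument. -/
structure Coefficients.A1 (c : Coefficients) (T L : ℝ) : Prop where
  lipschitz : ∀ t ∈ Set.Icc (0 : ℝ) T, ∀ (x x' y y' z z' : ℝ) (μ μ' : P2 Plane),
    |c.B t x' y' z' μ' - c.B t x y z μ| + |c.F t x' y' z' μ' - c.F t x y z μ|
        + |c.Sig t x' y' μ' - c.Sig t x y μ|
      ≤ L * (√((x - x') ^ 2 + (y - y') ^ 2 + (z - z') ^ 2) + W2 μ μ')
  lipschitz_G : ∀ (x x' : ℝ) (ν ν' : P2 ℝ), |c.G x' ν' - c.G x ν| ≤ L * (|x - x'| + W2 ν ν')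

/-- (A2): `Σ` and `G` are bounded, `B` and `F` have linear growth (with no growth of `F` in
the variables `x` and `z`). -/
structure Coefficients.A2 (c : Coefficients) (T L : ℝ) : Prop where
  bound_Sig : ∀ t ∈ Set.Icc (0 : ℝ) T, ∀ (x y : ℝ) (μ : P2 Plane), |c.Sig t x y μ| ≤ L
  bound_G : ∀ (x : ℝ) (ν : P2 ℝ), |c.G x ν| ≤ L
  growth_B : ∀ t ∈ Set.Icc (0 : ℝ) T, ∀ (x y z : ℝ) (μ : P2 Plane),
    |c.B t x y z μ| ≤ L * (1 + |x| + |y| + |z| + √(∫ v, ‖v‖ ^ 2 ∂μ.toMeasure))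
  growth_F : ∀ t ∈ Set.Icc (0 : ℝ) T, ∀ (x y z : ℝ) (μ : P2 Plane),
    |c.F t x y z μ| ≤ L * (1 + |y| + √(∫ v, |v.snd| ^ 2 ∂μ.toMeasure))

/-- (A3): `Σ` is uniformly elliptic and `t ↦ Σ(t, 0, 0, δ_{(0,0)})` is continuous on `[0, T]`. -/
structure Coefficients.A3 (c : Coefficients) (T L : ℝ) : Prop where
  elliptic : ∀ t ∈ Set.Icc (0 : ℝ) T, ∀ (x y : ℝ) (μ : P2 Plane),
    L⁻¹ ≤ c.Sig t x y μ * c.Sig t x y μ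
  continuousOn : ContinuousOn (fun t ↦ c.Sig t 0 0 (P2.dirac 0)) (Set.Icc 0 T)

/-- The standing assumptions: Borel measurability and (A1)–(A3) with a common constant `L ≥ 1`. -/
def Coefficients.Admissible (c : Coefficients) (T : ℝ) : Prop :=
  c.BorelMeasurable T ∧ ∃ L : ℝ, 1 ≤ L ∧ c.A1 T L ∧ c.A2 T L ∧ c.A3 T L

section Solution

variable {Ω : Type*} [MeasurableSpace Ω]

/-- The joint law `ℙ_{(X_t, Y_t)} ∈ 𝒫₂(ℝ × ℝ)`. -/
def jointLaw (P : Measure Ω) [IsProbabilityMeasure P] (X Y : ℝ → Ω → ℝ) (t : ℝ) : P2 Plane :=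
  law P (fun ω ↦ (WithLp.toLp 2 (X t ω, Y t ω) : Plane))

/-- `(X, Y, Z)` solves on `[0, T]` the McKean–Vlasov forward-backward system
`dX_t = B(t, X_t, Y_t, Z_t, ℙ_{(X_t, Y_t)}) dt + Σ(t, X_t, Y_t, ℙ_{(X_t, Y_t)}) dW_t`,
`dY_t = -F(t, X_t, Y_t, Z_t, ℙ_{(X_t, Y_t)}) dt + Z_t dW_t`,
`X_0 = x₀`, `Y_T = G(X_T, ℙ_{X_T})`:
`X` and `Y` are continuous, adapted and bounded in `L²`, `Z ∈ ℍ²`, and the equations hold in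
integral form. -/
structure IsSolution (P : Measure Ω) [IsProbabilityMeasure P] (T : ℝ) (W : ℝ → Ω → ℝ)
    (c : Coefficients) (x₀ : ℝ) (X Y Z : ℝ → Ω → ℝ) : Prop where
  adapted_X : AdaptedOn (wienerFiltration P W) T X
  adapted_Y : AdaptedOn (wienerFiltration P W) T Y
  continuous_X : ∀ᵐ ω ∂P, ContinuousOn (fun t ↦ X t ω) (Set.Icc 0 T)
  continuous_Y : ∀ᵐ ω ∂P, ContinuousOn (fun t ↦ Y t ω) (Set.Icc 0 T)
  memLp_X : ∀ t ∈ Set.Icc (0 : ℝ) T, MemLp (X t) 2 P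
  memLp_Y : ∀ t ∈ Set.Icc (0 : ℝ) T, MemLp (Y t) 2 P
  bounded_L2 : ∃ C : ℝ, ∀ t ∈ Set.Icc (0 : ℝ) T,
    ∫ ω, |X t ω| ^ 2 ∂P ≤ C ∧ ∫ ω, |Y t ω| ^ 2 ∂P ≤ C
  memH2_Z : MemH2 P (wienerFiltration P W) T Z
  integrable_B : ∀ᵐ ω ∂P, IntegrableOn
    (fun s ↦ c.B s (X s ω) (Y s ω) (Z s ω) (jointLaw P X Y s)) (Set.Icc 0 T)
  integrable_F : ∀ᵐ ω ∂P, IntegrableOn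
    (fun s ↦ c.F s (X s ω) (Y s ω) (Z s ω) (jointLaw P X Y s)) (Set.Icc 0 T)
  initial : ∀ᵐ ω ∂P, X 0 ω = x₀
  forward : ∃ M : ℝ → Ω → ℝ,
    IsItoIntegral P T W (fun s ω ↦ c.Sig s (X s ω) (Y s ω) (jointLaw P X Y s)) M ∧
    ∀ᵐ ω ∂P, ∀ t ∈ Set.Icc (0 : ℝ) T, X t ω = X 0 ω
      + (∫ s in (0 : ℝ)..t, c.B s (X s ω) (Y s ω) (Z s ω) (jointLaw P X Y s)) + M t ω
  backward : ∃ N : ℝ → Ω → ℝ, IsItoIntegral P T W Z N ∧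
    ∀ᵐ ω ∂P, ∀ t ∈ Set.Icc (0 : ℝ) T, Y t ω = Y 0 ω
      - (∫ s in (0 : ℝ)..t, c.F s (X s ω) (Y s ω) (Z s ω) (jointLaw P X Y s)) + N t ω
  terminal : ∀ᵐ ω ∂P, Y T ω = c.G (X T ω) (law P (X T))

/-- Uniqueness: any two solutions driven by `W` have indistinguishable components `X` and `Y`,
and components `Z` which agree `dt ⊗ ℙ`-almost everywhere. -/
def UniqueSolution (P : Measure Ω) [IsProbabilityMeasure P] (T : ℝ) (W : ℝ → Ω → ℝ)
    (c : Coefficients) (x₀ : ℝ) : Prop :=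
  ∀ X Y Z X' Y' Z' : ℝ → Ω → ℝ,
    IsSolution P T W c x₀ X Y Z → IsSolution P T W c x₀ X' Y' Z' →
      (∀ᵐ ω ∂P, ∀ t ∈ Set.Icc (0 : ℝ) T, X t ω = X' t ω ∧ Y t ω = Y' t ω) ∧
      ∀ᵐ q ∂((volume.restrict (Set.Icc 0 T)).prod P), Z q.1 q.2 = Z' q.1 q.2

end Solution

/-- The coefficients of the system
`dX_t = b(𝔼 Y_t) dt + dW_t`, `dY_t = -f(𝔼 X_t) dt + Z_t dW_t`, `Y_T = g(𝔼 X_T)`. -/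
def meanCoefficients (b f g : ℝ → ℝ) : Coefficients where
  B _ _ _ _ μ := b (∫ v, v.snd ∂μ.toMeasure)
  F _ _ _ _ μ := f (∫ v, v.fst ∂μ.toMeasure)
  Sig _ _ _ _ := 1
  G _ ν := g (∫ u, u ∂ν.toMeasure)

/-- `h` is bounded and Lipschitz continuous, and `h(x) = x` for `|x| ≤ R`. -/
structure IsTruncatedIdentity (R : ℝ) (h : ℝ → ℝ) : Prop where
  bounded : ∃ C : ℝ, ∀ x, |h x| ≤ C
  lipschitz : ∃ K : NNReal, LipschitzWith K h
  eq_self : ∀ x, |x| ≤ R → h x = x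

end McKeanVlasov

end

/-!
Along the processes `X_t = A sin t + W_t`, `Y_t = A cos t`, `Z_t = 0` the means are
`𝔼 X_t = A sin t` and `𝔼 Y_t = A cos t`. For `|A| ≤ R` they stay in the region where the truncated
identities act as the identity, so the system reduces to the linear boundary value problem
`x' = y`, `y' = -x`, `x(0) = 0`, `y(T) = x(T)`. As `sin` and `cos` agree at `T = π / 4`, the terminal
condition holds for every `A`: the boundary value problem is resonant and has a line of solutions.

The coefficients depend on the law only through a mean, and the mean is `1`-Lipschitz for `W₂`
(`McKeanVlasov.abs_integral_sub_integral_le_W2`). This gives the Lipschitz condition, and also measurability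
for the Borel `σ`-field of `𝒫₂` (`McKeanVlasov.P2.measurable_integral_of_lipschitz`).
-/

namespace McKeanVlasov

open scoped ENNReal NNReal

/-! ### Lipschitz functionals on the Wasserstein space -/

section Wasserstein

variable {E : Type*} [NormedAddCommGroup E] [MeasurableSpace E]

lemma isCoupling_prod (μ ν : P2 E) :
    IsCoupling μ.toMeasure ν.toMeasure (μ.toMeasure.prod ν.toMeasure) := by
  have hμ := μ.isProb
  have hν := ν.isProb
  exact ⟨by simp, by simp⟩

lemma isCoupling_diag (μ : P2 E) :
    IsCoupling μ.toMeasure μ.toMeasure (μ.toMeasure.map fun x ↦ (x, x)) := by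
  have h : Measurable fun x : E ↦ (x, x) := by fun_prop
  constructor
  · rw [Measure.map_map measurable_fst h]
    exact Measure.map_id
  · rw [Measure.map_map measurable_snd h]
    exact Measure.map_id

lemma W2_nonneg (μ ν : P2 E) : 0 ≤ W2 μ ν := ENNReal.toReal_nonneg

lemma lintegral_edist_sq_lt_top {μ ν : P2 E} {π : Measure (E × E)}
    (hπ : IsCoupling μ.toMeasure ν.toMeasure π) : ∫⁻ p, edist p.1 p.2 ^ 2 ∂π < ∞ := by
  have h1 : MemLp (fun p : E × E ↦ p.1) 2 π := by
    have := μ.memLp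
    rw [← hπ.1] at this
    exact this.comp_of_map measurable_fst.aemeasurable
  have h2 : MemLp (fun p : E × E ↦ p.2) 2 π := by
    have := ν.memLp
    rw [← hπ.2] at this
    exact this.comp_of_map measurable_snd.aemeasurable
  have h := (h1.sub h2).eLpNorm_lt_top
  rw [eLpNorm_lt_top_iff_lintegral_rpow_enorm_lt_top two_ne_zero ENNReal.ofNat_ne_top] at h
  simpa [edist_eq_enorm_sub] using h

variable [BorelSpace E]

lemma P2.memLp_of_lipschitz (μ : P2 E) {φ : E → ℝ} (hφ : LipschitzWith 1 φ) :
    MemLp φ 2 μ.toMeasure := by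
  have := μ.isProb
  have hn : MemLp (fun x : E ↦ ‖x‖) 2 μ.toMeasure := μ.memLp.norm
  have hc : MemLp (fun _ : E ↦ ‖φ 0‖) 2 μ.toMeasure := memLp_const _
  refine (hc.add hn).mono hφ.continuous.aestronglyMeasurable (Eventually.of_forall fun x ↦ ?_)
  have h1 : ‖φ x - φ 0‖ ≤ ‖x‖ := by
    simpa [dist_eq_norm] using hφ.dist_le_mul x 0
  have h2 : ‖φ x‖ ≤ ‖φ 0‖ + ‖φ x - φ 0‖ := by
    simpa using norm_add_le (φ 0) (φ x - φ 0)
  rw [Pi.add_apply, Real.norm_of_nonneg (add_nonneg (norm_nonneg _) (norm_nonneg _))]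
  linarith

lemma P2.integrable_of_lipschitz (μ : P2 E) {φ : E → ℝ} (hφ : LipschitzWith 1 φ) :
    Integrable φ μ.toMeasure :=
  have := μ.isProb
  (μ.memLp_of_lipschitz hφ).integrable one_le_two

/-- The dual bound for `W₂`: integrals of `1`-Lipschitz functions are `1`-Lipschitz in the measure.
For each coupling it is the Cauchy–Schwarz inequality. -/
lemma abs_integral_sub_integral_le_W2 {φ : E → ℝ} (hφ : LipschitzWith 1 φ) (μ ν : P2 E) :
    |∫ x, φ x ∂μ.toMeasure - ∫ x, φ x ∂ν.toMeasure| ≤ W2 μ ν := by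
  have hfin : (⨅ (π : Measure (E × E)) (_ : IsCoupling μ.toMeasure ν.toMeasure π),
      (∫⁻ p, edist p.1 p.2 ^ 2 ∂π) ^ (1 / 2 : ℝ)) ≠ ∞ := by
    refine ((iInf₂_le _ (isCoupling_prod μ ν)).trans_lt ?_).ne
    exact ENNReal.rpow_lt_top_of_nonneg (by norm_num)
      (lintegral_edist_sq_lt_top (isCoupling_prod μ ν)).ne
  rw [W2, ← ENNReal.ofReal_le_iff_le_toReal hfin]
  refine le_iInf₂ fun π hπ ↦ ?_
  have : IsProbabilityMeasure π := by
    have := μ.isProb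
    rw [← hπ.1] at this
    exact Measure.isProbabilityMeasure_of_map Prod.fst
  have hφm : ∀ m : Measure E, AEStronglyMeasurable φ m :=
    fun m ↦ hφ.continuous.aestronglyMeasurable
  have i1 : Integrable (fun p : E × E ↦ φ p.1) π := by
    have := μ.integrable_of_lipschitz hφ
    rw [← hπ.1] at this
    exact this.comp_measurable measurable_fst
  have i2 : Integrable (fun p : E × E ↦ φ p.2) π := by
    have := ν.integrable_of_lipschitz hφ
    rw [← hπ.2] at this
    exact this.comp_measurable measurable_snd
  have e1 : ∫ x, φ x ∂μ.toMeasure = ∫ p, φ p.1 ∂π := by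
    rw [← hπ.1, integral_map measurable_fst.aemeasurable (hφm _)]
  have e2 : ∫ x, φ x ∂ν.toMeasure = ∫ p, φ p.2 ∂π := by
    rw [← hπ.2, integral_map measurable_snd.aemeasurable (hφm _)]
  rw [e1, e2, ← integral_sub i1 i2, ← Real.enorm_eq_ofReal_abs]
  calc ‖∫ p, (φ p.1 - φ p.2) ∂π‖ₑ
      ≤ ∫⁻ p, ‖φ p.1 - φ p.2‖ₑ ∂π := enorm_integral_le_lintegral_enorm _
    _ = eLpNorm (fun p : E × E ↦ φ p.1 - φ p.2) 1 π := eLpNorm_one_eq_lintegral_enorm.symm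
    _ ≤ eLpNorm (fun p : E × E ↦ φ p.1 - φ p.2) 2 π :=
        eLpNorm_le_eLpNorm_of_exponent_le one_le_two (i1.sub i2).aestronglyMeasurable
    _ = (∫⁻ p, ‖φ p.1 - φ p.2‖ₑ ^ 2 ∂π) ^ (1 / 2 : ℝ) := by
        rw [eLpNorm_eq_lintegral_rpow_enorm_toReal two_ne_zero ENNReal.ofNat_ne_top]
        simp
    _ ≤ (∫⁻ p, edist p.1 p.2 ^ 2 ∂π) ^ (1 / 2 : ℝ) := by
        gcongr with p
        simpa [edist_eq_enorm_sub] using hφ p.1 p.2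

variable [SecondCountableTopology E]

lemma W2_self (μ : P2 E) : W2 μ μ = 0 := by
  have h : (⨅ (π : Measure (E × E)) (_ : IsCoupling μ.toMeasure μ.toMeasure π),
      (∫⁻ p, edist p.1 p.2 ^ 2 ∂π) ^ (1 / 2 : ℝ)) ≤ 0 := by
    refine (iInf₂_le _ (isCoupling_diag μ)).trans ?_
    rw [lintegral_map (by fun_prop) (by fun_prop)]
    simp
  rw [W2, le_antisymm h zero_le, ENNReal.toReal_zero]

/-- The topology of `𝒫₂` is generated by balls, and each measure lies in the balls centred at it;
the dual bound therefore yields continuity without the triangle inequality for `W₂`. -/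
lemma P2.measurable_integral_of_lipschitz {φ : E → ℝ} (hφ : LipschitzWith 1 φ) :
    Measurable fun μ : P2 E ↦ ∫ x, φ x ∂μ.toMeasure := by
  have : BorelSpace (P2 E) := ⟨rfl⟩
  refine Continuous.measurable (continuous_iff_continuousAt.2 fun μ ↦ ?_)
  refine Metric.tendsto_nhds.2 fun ε hε ↦ ?_
  have hball : IsOpen {ν | W2 μ ν < ε} := TopologicalSpace.isOpen_generateFrom_of_mem ⟨μ, ε, rfl⟩
  filter_upwards [hball.mem_nhds (show W2 μ μ < ε by rwa [W2_self])] with ν hν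
  rw [dist_comm, Real.dist_eq]
  exact (abs_integral_sub_integral_le_W2 hφ μ ν).trans_lt hν

end Wasserstein

lemma lipschitzWith_plane_fst : LipschitzWith 1 fun v : Plane ↦ v.fst :=
  LipschitzWith.of_dist_le_mul fun v w ↦ by
    simpa using WithLp.dist_fst_le v w

lemma lipschitzWith_plane_snd : LipschitzWith 1 fun v : Plane ↦ v.snd :=
  LipschitzWith.of_dist_le_mul fun v w ↦ by
    simpa using WithLp.dist_snd_le v w

/-! ### Admissibility of mean-field coefficients -/

/-- Bounded Lipschitz functions of the means give admissible coefficients: one plus the sum of all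
bounds and Lipschitz constants serves as the common constant. -/
lemma meanCoefficients_admissible {b f g : ℝ → ℝ} {Cb Cf Cg : ℝ} {Kb Kf Kg : ℝ≥0}
    (hb : ∀ x, |b x| ≤ Cb) (hf : ∀ x, |f x| ≤ Cf) (hg : ∀ x, |g x| ≤ Cg)
    (lb : LipschitzWith Kb b) (lf : LipschitzWith Kf f) (lg : LipschitzWith Kg g) (T : ℝ) :
    (meanCoefficients b f g).Admissible T := by
  have hCb : 0 ≤ Cb := (abs_nonneg _).trans (hb 0)
  have hCf : 0 ≤ Cf := (abs_nonneg _).trans (hf 0)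
  have hCg : 0 ≤ Cg := (abs_nonneg _).trans (hg 0)
  have key : ∀ {E : Type} [NormedAddCommGroup E] [MeasurableSpace E] [BorelSpace E]
      [SecondCountableTopology E] {K : ℝ≥0} {h : ℝ → ℝ} {φ : E → ℝ}, LipschitzWith K h →
      LipschitzWith 1 φ → ∀ μ μ' : P2 E,
      |h (∫ x, φ x ∂μ'.toMeasure) - h (∫ x, φ x ∂μ.toMeasure)| ≤ K * W2 μ μ' := by
    intro E _ _ _ _ K h φ hh hφ μ μ'
    rw [abs_sub_comm]
    refine (hh.dist_le_mul _ _).trans ?_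
    exact mul_le_mul_of_nonneg_left (abs_integral_sub_integral_le_W2 hφ μ μ') K.2
  refine ⟨⟨?_, ?_, ?_, ?_⟩, 1 + Cb + Cf + Cg + Kb + Kf + Kg, ?_, ⟨?_, ?_⟩, ⟨?_, ?_, ?_, ?_⟩,
    ⟨?_, ?_⟩⟩
  · exact lb.continuous.measurable.comp
      ((P2.measurable_integral_of_lipschitz lipschitzWith_plane_snd).comp (by fun_prop))
  · exact lf.continuous.measurable.comp
      ((P2.measurable_integral_of_lipschitz lipschitzWith_plane_fst).comp (by fun_prop))
  · exact measurable_const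
  · exact lg.continuous.measurable.comp
      ((P2.measurable_integral_of_lipschitz LipschitzWith.id).comp measurable_snd)
  · linarith [Kb.coe_nonneg, Kf.coe_nonneg, Kg.coe_nonneg]
  · intro t _ x x' y y' z z' μ μ'
    have h1 := key lb lipschitzWith_plane_snd μ μ'
    have h2 := key lf lipschitzWith_plane_fst μ μ'
    have hs := Real.sqrt_nonneg ((x - x') ^ 2 + (y - y') ^ 2 + (z - z') ^ 2)
    have hW := W2_nonneg μ μ'
    simp only [meanCoefficients, sub_self, abs_zero, add_zero]
    calc _ ≤ Kb * W2 μ μ' + Kf * W2 μ μ' := add_le_add h1 h2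
      _ = (Kb + Kf) * W2 μ μ' := by ring
      _ ≤ _ := by
        gcongr ?_ * ?_
        · linarith [Kg.coe_nonneg]
        · linarith
  · intro x x' ν ν'
    have h1 := key lg LipschitzWith.id ν ν'
    have hW := W2_nonneg ν ν'
    have hs := abs_nonneg (x - x')
    refine h1.trans ?_
    gcongr ?_ * ?_
    · linarith [Kb.coe_nonneg, Kf.coe_nonneg]
    · linarith
  · intro t _ x y μ
    simp only [meanCoefficients, abs_one]
    linarith [Kb.coe_nonneg, Kf.coe_nonneg, Kg.coe_nonneg]
  · intro x ν
    refine (hg _).trans ?_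
    linarith [Kb.coe_nonneg, Kf.coe_nonneg, Kg.coe_nonneg]
  · intro t _ x y z μ
    have hs := Real.sqrt_nonneg (∫ v, ‖v‖ ^ 2 ∂μ.toMeasure)
    refine ((hb _).trans ?_).trans (le_mul_of_one_le_right ?_ ?_)
    · linarith [Kb.coe_nonneg, Kf.coe_nonneg, Kg.coe_nonneg]
    · linarith [Kb.coe_nonneg, Kf.coe_nonneg, Kg.coe_nonneg]
    · linarith [abs_nonneg x, abs_nonneg y, abs_nonneg z]
  · intro t _ x y z μ
    have hs := Real.sqrt_nonneg (∫ v, |v.snd| ^ 2 ∂μ.toMeasure)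
    refine ((hf _).trans ?_).trans (le_mul_of_one_le_right ?_ ?_)
    · linarith [Kb.coe_nonneg, Kf.coe_nonneg, Kg.coe_nonneg]
    · linarith [Kb.coe_nonneg, Kf.coe_nonneg, Kg.coe_nonneg]
    · linarith [abs_nonneg y]
  · intro t _ x y μ
    simp only [meanCoefficients, mul_one]
    refine inv_le_one_of_one_le₀ ?_
    linarith [Kb.coe_nonneg, Kf.coe_nonneg, Kg.coe_nonneg]
  · exact continuousOn_const

lemma IsTruncatedIdentity.meanCoefficients_admissible {R : ℝ} {b f g : ℝ → ℝ}
    (hb : IsTruncatedIdentity R b) (hf : IsTruncatedIdentity R f) (hg : IsTruncatedIdentity R g)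
    (T : ℝ) : (meanCoefficients b f g).Admissible T := by
  obtain ⟨Cb, hCb⟩ := hb.bounded
  obtain ⟨Cf, hCf⟩ := hf.bounded
  obtain ⟨Cg, hCg⟩ := hg.bounded
  obtain ⟨Kb, hKb⟩ := hb.lipschitz
  obtain ⟨Kf, hKf⟩ := hf.lipschitz
  obtain ⟨Kg, hKg⟩ := hg.lipschitz
  exact McKeanVlasov.meanCoefficients_admissible hCb hCf hCg hKb hKf hKg T

lemma isTruncatedIdentity_clamp {R : ℝ} (hR : 0 ≤ R) :
    IsTruncatedIdentity R fun x ↦ max (-R) (min x R) where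
  bounded := ⟨R, fun x ↦ abs_le.2 ⟨le_max_left _ _, max_le (by linarith) (min_le_right _ _)⟩⟩
  lipschitz := ⟨1, (LipschitzWith.id.min_const R).const_max (-R)⟩
  eq_self x hx := by
    rw [min_eq_left (abs_le.1 hx).2, max_eq_right (abs_le.1 hx).1]

/-! ### The Wiener process and its Itô integrals -/

section Wiener

variable {Ω : Type*} [MeasurableSpace Ω] {P : Measure Ω} {T : ℝ} {W : ℝ → Ω → ℝ}

lemma IsWiener.hasLaw (hW : IsWiener P T W) {t : ℝ} (ht : t ∈ Set.Icc 0 T) :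
    HasLaw (W t) (gaussianReal 0 t.toNNReal) P := by
  have h := hW.hasLaw_increment 0 t le_rfl ht.1 ht.2
  rw [sub_zero] at h
  refine h.congr ?_
  filter_upwards [hW.zero] with ω hω
  rw [hω, sub_zero]

lemma IsWiener.memLp (hW : IsWiener P T W) {t : ℝ} (ht : t ∈ Set.Icc 0 T) :
    MemLp (W t) 2 P := by
  have h := memLp_id_gaussianReal (μ := 0) (v := t.toNNReal) 2
  rw [← (hW.hasLaw ht).map_eq] at h
  exact h.comp_of_map (hW.hasLaw ht).aemeasurable

lemma IsWiener.integral_eq_zero (hW : IsWiener P T W) {t : ℝ} (ht : t ∈ Set.Icc 0 T) :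
    ∫ ω, W t ω ∂P = 0 := by
  rw [(hW.hasLaw ht).integral_eq, integral_id_gaussianReal]

lemma IsWiener.integral_sq [IsProbabilityMeasure P] (hW : IsWiener P T W) {t : ℝ}
    (ht : t ∈ Set.Icc 0 T) : ∫ ω, W t ω ^ 2 ∂P = t := by
  rw [← variance_of_integral_eq_zero (hW.hasLaw ht).aemeasurable (hW.integral_eq_zero ht),
    (hW.hasLaw ht).variance_eq, variance_id_gaussianReal, Real.coe_toNNReal _ ht.1]

lemma adaptedOn_wienerFiltration (W : ℝ → Ω → ℝ) : AdaptedOn (wienerFiltration P W) T W := by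
  intro t ht
  refine (comap_measurable (W t)).mono ?_ le_rfl
  refine le_trans ?_ (le_sup_left : pastSigma W t ≤ _)
  exact le_iSup₂_of_le
    (f := fun s (_ : s ∈ Set.Icc 0 t) ↦ MeasurableSpace.comap (W s) inferInstance) t
    ⟨ht.1, le_rfl⟩ le_rfl

/-- The Wiener process is the Itô integral of the constant `1`, which is itself simple up to the
null set of times `{0}`. -/
lemma IsWiener.isItoIntegral_one [IsProbabilityMeasure P] (hW : IsWiener P T W) (hT : 0 ≤ T) :
    IsItoIntegral P T W (fun _ _ ↦ 1) W where
  aestronglyMeasurable := aestronglyMeasurable_const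
  adapted := adaptedOn_wienerFiltration W
  continuous := hW.continuous
  approx := by
    refine ⟨fun _ ↦
      { n := 1
        t := fun i ↦ if i = 0 then 0 else T
        mono := monotone_nat_of_le_succ fun i ↦ by
          by_cases hi : i = 0 <;> simp [hi, hT]
        mem := fun i ↦ by by_cases hi : i = 0 <;> simp [hi, hT]
        ξ := fun _ _ ↦ 1
        measurable := fun _ ↦ measurable_const
        bounded := fun _ ↦ ⟨1, fun _ ↦ by simp⟩ }, ?_, fun t ht ↦ ?_⟩
    · refine tendsto_const_nhds.congr fun _ ↦ (lintegral_eq_zero_of_ae_eq_zero ?_).symm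
      have h0 : ∀ᵐ s ∂volume.restrict (Set.Icc 0 T), s ∈ Set.Ioc 0 T := by
        rw [← restrict_Ioc_eq_restrict_Icc]
        exact ae_restrict_mem measurableSet_Ioc
      filter_upwards [Measure.quasiMeasurePreserving_fst.ae h0] with p hp
      simp [SimpleProcess.val, Set.indicator_of_mem hp]
    · refine tendsto_const_nhds.congr fun _ ↦ (lintegral_eq_zero_of_ae_eq_zero ?_).symm
      filter_upwards [hW.zero] with ω hω
      simp [SimpleProcess.integral, ht.1, ht.2, hω]

lemma isItoIntegral_zero (hT : 0 ≤ T) :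
    IsItoIntegral P T W (fun _ _ ↦ 0) (fun _ _ ↦ 0) where
  aestronglyMeasurable := aestronglyMeasurable_const
  adapted _ _ := measurable_const
  continuous := Eventually.of_forall fun _ ↦ continuousOn_const
  approx := by
    refine ⟨fun _ ↦
      { n := 0
        t := fun _ ↦ 0
        mono := monotone_const
        mem := fun _ ↦ ⟨le_rfl, hT⟩
        ξ := fun _ _ ↦ 0
        measurable := fun _ ↦ measurable_const
        bounded := fun _ ↦ ⟨0, fun _ ↦ by simp⟩ }, ?_, fun t _ ↦ ?_⟩
    · simp [SimpleProcess.val]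
    · simp [SimpleProcess.integral]

end Wiener

/-! ### The family of solutions -/

section Solution

variable {Ω : Type*} [MeasurableSpace Ω] {P : Measure Ω}

lemma memLp_toLp_prodMk {X Y : Ω → ℝ} (hX : MemLp X 2 P) (hY : MemLp Y 2 P) :
    MemLp (fun ω ↦ (WithLp.toLp 2 (X ω, Y ω) : Plane)) 2 P := by
  refine (hX.norm.add hY.norm).mono ?_ (Eventually.of_forall fun ω ↦ ?_)
  · exact (WithLp.prod_continuous_toLp 2 ℝ ℝ).comp_aestronglyMeasurable (hX.1.prodMk hY.1)
  · rw [WithLp.prod_norm_eq_of_L2]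
    simp only [Pi.add_apply]
    rw [Real.norm_of_nonneg (by positivity : (0 : ℝ) ≤ ‖X ω‖ + ‖Y ω‖)]
    refine Real.sqrt_le_iff.2 ⟨by positivity, ?_⟩
    change ‖X ω‖ ^ 2 + ‖Y ω‖ ^ 2 ≤ _
    nlinarith [mul_nonneg (norm_nonneg (X ω)) (norm_nonneg (Y ω))]

variable [IsProbabilityMeasure P]

lemma law_toMeasure {E : Type*} [NormedAddCommGroup E] [MeasurableSpace E] [BorelSpace E]
    [SecondCountableTopology E] {X : Ω → E} (hX : MemLp X 2 P) :
    (law P X).toMeasure = P.map X := by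
  rw [law, dif_pos hX]

lemma integral_law {E : Type*} [NormedAddCommGroup E] [MeasurableSpace E] [BorelSpace E]
    [SecondCountableTopology E] {X : Ω → E} (hX : MemLp X 2 P) {φ : E → ℝ} (hφ : Continuous φ) :
    ∫ x, φ x ∂(law P X).toMeasure = ∫ ω, φ (X ω) ∂P := by
  rw [law_toMeasure hX, integral_map hX.1.aemeasurable hφ.aestronglyMeasurable]

lemma integral_fst_jointLaw {X Y : ℝ → Ω → ℝ} {t : ℝ} (hX : MemLp (X t) 2 P)
    (hY : MemLp (Y t) 2 P) : ∫ v, v.fst ∂(jointLaw P X Y t).toMeasure = ∫ ω, X t ω ∂P :=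
  integral_law (memLp_toLp_prodMk hX hY) lipschitzWith_plane_fst.continuous

lemma integral_snd_jointLaw {X Y : ℝ → Ω → ℝ} {t : ℝ} (hX : MemLp (X t) 2 P)
    (hY : MemLp (Y t) 2 P) : ∫ v, v.snd ∂(jointLaw P X Y t).toMeasure = ∫ ω, Y t ω ∂P :=
  integral_law (memLp_toLp_prodMk hX hY) lipschitzWith_plane_snd.continuous

lemma abs_mul_le_of_abs_le_one {A R c : ℝ} (hA : |A| ≤ R) (hc : |c| ≤ 1) : |A * c| ≤ R := by
  rw [abs_mul]
  exact (mul_le_of_le_one_right (abs_nonneg A) hc).trans hA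

/-- The explicit family of solutions; the martingale part of `X` is `W` itself, and `Y` is
deterministic. -/
lemma isSolution_sin_cos {W : ℝ → Ω → ℝ} (hW : IsWiener P (Real.pi / 4) W) {R : ℝ}
    {b f g : ℝ → ℝ} (hb : IsTruncatedIdentity R b) (hf : IsTruncatedIdentity R f)
    (hg : IsTruncatedIdentity R g) {A : ℝ} (hA : |A| ≤ R) :
    IsSolution P (Real.pi / 4) W (meanCoefficients b f g) 0
      (fun t ω ↦ A * Real.sin t + W t ω) (fun t _ ↦ A * Real.cos t) (fun _ _ ↦ 0) := by
  have hT : 0 ≤ Real.pi / 4 := by positivity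
  have hX : ∀ t ∈ Set.Icc (0 : ℝ) (Real.pi / 4), MemLp (fun ω ↦ A * Real.sin t + W t ω) 2 P :=
    fun t ht ↦ MemLp.add (memLp_const (A * Real.sin t)) (hW.memLp ht)
  have hY : ∀ t : ℝ, MemLp (fun _ : Ω ↦ A * Real.cos t) 2 P := fun t ↦ memLp_const (A * Real.cos t)
  have hEX : ∀ t ∈ Set.Icc (0 : ℝ) (Real.pi / 4),
      ∫ ω, (A * Real.sin t + W t ω) ∂P = A * Real.sin t := by
    intro t ht
    rw [integral_add (integrable_const _) ((hW.memLp ht).integrable one_le_two),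
      hW.integral_eq_zero ht]
    simp
  let c := meanCoefficients b f g
  let X : ℝ → Ω → ℝ := fun t ω ↦ A * Real.sin t + W t ω
  let Y : ℝ → Ω → ℝ := fun t _ ↦ A * Real.cos t
  -- along the processes the means stay in `[-R, R]`, where `b` and `f` are the identity
  have hB : ∀ t ∈ Set.Icc (0 : ℝ) (Real.pi / 4), ∀ x y z : ℝ,
      c.B t x y z (jointLaw P X Y t) = A * Real.cos t := by
    intro t ht x y z
    change b (∫ v, v.snd ∂(jointLaw P X Y t).toMeasure) = _
    rw [integral_snd_jointLaw (hX t ht) (hY t)]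
    simp only [Y, integral_const, probReal_univ, one_smul]
    exact hb.eq_self _ (abs_mul_le_of_abs_le_one hA (Real.abs_cos_le_one t))
  have hF : ∀ t ∈ Set.Icc (0 : ℝ) (Real.pi / 4), ∀ x y z : ℝ,
      c.F t x y z (jointLaw P X Y t) = A * Real.sin t := by
    intro t ht x y z
    change f (∫ v, v.fst ∂(jointLaw P X Y t).toMeasure) = _
    rw [integral_fst_jointLaw (hX t ht) (hY t), hEX t ht]
    exact hf.eq_self _ (abs_mul_le_of_abs_le_one hA (Real.abs_sin_le_one t))
  have hsub : ∀ t ∈ Set.Icc (0 : ℝ) (Real.pi / 4), ∀ s ∈ Set.uIcc 0 t,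
      s ∈ Set.Icc (0 : ℝ) (Real.pi / 4) := by
    intro t ht s hs
    rw [Set.uIcc_of_le ht.1] at hs
    exact ⟨hs.1, hs.2.trans ht.2⟩
  refine ⟨?_, ?_, ?_, ?_, hX, fun t _ ↦ hY t, ?_, ⟨?_, ?_⟩, ?_, ?_, ?_, ?_, ?_, ?_⟩
  · exact fun t ht ↦ (adaptedOn_wienerFiltration W t ht).const_add _
  · exact fun t _ ↦ measurable_const
  · filter_upwards [hW.continuous] with ω hω
    exact (Continuous.continuousOn (by fun_prop)).add hω
  · exact Eventually.of_forall fun _ ↦ Continuous.continuousOn (by fun_prop)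
  · refine ⟨2 * A ^ 2 + 2 * (Real.pi / 4), fun t ht ↦ ⟨?_, ?_⟩⟩
    · have hsq := (hW.memLp ht).integrable_sq
      calc ∫ ω, |X t ω| ^ 2 ∂P
          ≤ ∫ ω, (2 * A ^ 2 + 2 * W t ω ^ 2) ∂P := by
            refine integral_mono_of_nonneg (Eventually.of_forall fun ω ↦ by positivity)
              ((integrable_const _).add (hsq.const_mul 2)) (Eventually.of_forall fun ω ↦ ?_)
            simp only [X, sq_abs]
            -- `(a + w)² ≤ 2 a² + 2 w²`, and `(A sin t)² ≤ A²`
            nlinarith [sq_nonneg (A * Real.sin t - W t ω), sq_nonneg (A * Real.cos t),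
              Real.sin_sq_add_cos_sq t]
        _ = 2 * A ^ 2 + 2 * t := by
            rw [integral_add (integrable_const _) (hsq.const_mul 2),
              integral_const_mul 2 fun ω ↦ W t ω ^ 2, hW.integral_sq ht]
            simp
        _ ≤ _ := by linarith [ht.2]
    · simp only [integral_const, probReal_univ, one_smul, sq_abs]
      nlinarith [sq_nonneg (A * Real.sin t), Real.sin_sq_add_cos_sq t, sq_nonneg A]
  · exact fun t _ ↦ measurable_const
  · simp
  · refine Eventually.of_forall fun ω ↦ ?_
    refine IntegrableOn.congr_fun ?_ (fun s hs ↦ (hB s hs _ _ _).symm) measurableSet_Icc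
    exact (Continuous.continuousOn (by fun_prop)).integrableOn_Icc
  · refine Eventually.of_forall fun ω ↦ ?_
    refine IntegrableOn.congr_fun ?_ (fun s hs ↦ (hF s hs _ _ _).symm) measurableSet_Icc
    exact (Continuous.continuousOn (by fun_prop)).integrableOn_Icc
  · filter_upwards [hW.zero] with ω hω
    simp [hω]
  · refine ⟨W, hW.isItoIntegral_one hT, ?_⟩
    filter_upwards [hW.zero] with ω hω t ht
    rw [intervalIntegral.integral_congr fun s hs ↦ hB s (hsub t ht s hs) _ _ _,
      intervalIntegral.integral_const_mul, integral_cos]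
    simp [hω]
  · refine ⟨fun _ _ ↦ 0, isItoIntegral_zero hT, Eventually.of_forall fun ω t ht ↦ ?_⟩
    rw [intervalIntegral.integral_congr fun s hs ↦ hF s (hsub t ht s hs) _ _ _,
      intervalIntegral.integral_const_mul, integral_sin]
    simp only [Real.cos_zero]
    ring
  · refine Eventually.of_forall fun ω ↦ ?_
    have hmem : Real.pi / 4 ∈ Set.Icc (0 : ℝ) (Real.pi / 4) := ⟨hT, le_rfl⟩
    -- the resonance: `cos (π / 4) = sin (π / 4)`
    change A * Real.cos (Real.pi / 4) = g (∫ u, u ∂(law P (X (Real.pi / 4))).toMeasure)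
    rw [integral_law (hX _ hmem) continuous_id', hEX _ hmem,
      hg.eq_self _ (abs_mul_le_of_abs_le_one hA (Real.abs_sin_le_one _)),
      Real.sin_pi_div_four, Real.cos_pi_div_four]

/-- The solutions with `A = 0` and `A = R` have different initial values `Y_0 = A`. -/
lemma not_uniqueSolution {W : ℝ → Ω → ℝ} (hW : IsWiener P (Real.pi / 4) W) {R : ℝ} (hR : 0 < R)
    {b f g : ℝ → ℝ} (hb : IsTruncatedIdentity R b) (hf : IsTruncatedIdentity R f)
    (hg : IsTruncatedIdentity R g) :
    ¬ UniqueSolution P (Real.pi / 4) W (meanCoefficients b f g) 0 := by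
  intro h
  have h0 := isSolution_sin_cos hW hb hf hg (A := 0) (by simpa using hR.le)
  have h1 := isSolution_sin_cos hW hb hf hg (A := R) (abs_of_pos hR).le
  obtain ⟨ω, hω⟩ := (h _ _ _ _ _ _ h0 h1).1.exists
  have := (hω 0 ⟨le_rfl, by positivity⟩).2
  simp only [Real.cos_zero, mul_one] at this
  exact hR.ne this

end Solution

end McKeanVlasov

theorem mainTheorem3 {Ω : Type*} [MeasurableSpace Ω] (P : Measure Ω) [IsProbabilityMeasure P]
    (W : ℝ → Ω → ℝ) (hW : McKeanVlasov.IsWiener P (Real.pi / 4) W) :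
    (∀ (R : ℝ) (B F G : ℝ → ℝ),
      McKeanVlasov.IsTruncatedIdentity R B →
      McKeanVlasov.IsTruncatedIdentity R F →
      McKeanVlasov.IsTruncatedIdentity R G →
        (McKeanVlasov.meanCoefficients B F G).Admissible (Real.pi / 4) ∧
        (∀ A : ℝ, |A| ≤ R →
          McKeanVlasov.IsSolution P (Real.pi / 4) W (McKeanVlasov.meanCoefficients B F G) 0
            (fun t ω ↦ A * Real.sin t + W t ω) (fun t _ ↦ A * Real.cos t) (fun _ _ ↦ 0)) ∧
        (0 < R → ¬ McKeanVlasov.UniqueSolution P (Real.pi / 4) W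
          (McKeanVlasov.meanCoefficients B F G) 0)) ∧
    ∃ c : McKeanVlasov.Coefficients, c.Admissible (Real.pi / 4) ∧
      ¬ McKeanVlasov.UniqueSolution P (Real.pi / 4) W c 0 := by
  refine ⟨fun R B F G hB hF hG ↦ ⟨hB.meanCoefficients_admissible hF hG _, fun A hA ↦
    McKeanVlasov.isSolution_sin_cos hW hB hF hG hA, fun hR ↦
    McKeanVlasov.not_uniqueSolution hW hR hB hF hG⟩, ?_⟩
  have h := McKeanVlasov.isTruncatedIdentity_clamp zero_le_one
  exact ⟨_, h.meanCoefficients_admissible h h _,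
    McKeanVlasov.not_uniqueSolution hW one_pos h h h⟩
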